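/- Let $\delta \le \kappa$ be uncountable cardinals. Recall that $\kappa$ is *$\delta$-strongly compact* if for every set $A$, every proper $\kappa$-complete filter over $A$ (i.e. closed under intersections of fewer than $\kappa$ members) can be extended to a $\delta$-complete ultrafilter over $A$. Let $(V,\in)$ be the universe of sets. By a *definable elementary embedding $j : V \to M$ into a transitive model $M$* we mean a map $j$ from $V$ to a transitive class $M$ such that $M$ and $j$ are first-order definable over $(V,\in)$ with set parameters and $j$ is elementary from $(V,\in)$ to $(M,\in)$ for all first-order formulas in the language $\{\in\}$. Its critical point $\mathrm{crit}(j)$ is the least ordinal $\alpha$ with $j(\alpha)\neq\alpha$ (if it exists), and $j``\lambda=\{j(\alpha)\mid\alpha<\lambda\}$. Then the following are equivalent: 1. $\kappa$ is $\delta$-strongly compact. 2. For every regular cardinal $\lambda \ge \kappa$ there is a definable elementary embedding $j : V \to M$ into some transitive model $M$ such that $\mathrm{crit}(j)$ exists, $\delta \le \mathrm{crit}(j) \le \kappa$ and $\sup(j``\lambda) < j(\lambda)$. 3. For every regular cardinal $\lambda \ge \kappa$ there is a definable elementary embedding $j : V \to M$ into some transitive model $M$ such that $\mathrm{crit}(j)$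 exists, $\delta \le \mathrm{crit}(j)$ and $\sup(j``\lambda) < j(\lambda)$. -/

import Mathlib

open Cardinal

universe u

namespace StronglyCompact

open scoped FirstOrder

/-- `κ` is `δ`-strongly compact: for every set `A`, every (proper) `κ`-complete filter over `A`
extends to a `δ`-complete ultrafilter over `A`.
`CardinalInterFilter F c` says that `F` is closed under intersections of fewer than `c` members. -/
def IsStronglyCompact (δ κ : Cardinal.{u}) : Prop :=
  ∀ (A : Type u) (F : Filter A), F.NeBot → CardinalInterFilter F κ →
    ∃ U : Ultrafilter A, (U : Filter A) ≤ F ∧ CardinalInterFilter (U : Filter A) δ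

/-- Relation symbols of the first-order language of set theory: a single binary symbol. -/
inductive MemRel : ℕ → Type
  | mem : MemRel 2

/-- The first-order language `{∈}` of set theory. -/
def setLang : FirstOrder.Language.{0, 0} := ⟨fun _ => Empty, MemRel⟩

/-- The universe of sets `(V, ∈)` as a first-order structure. -/
instance instStructureV : setLang.Structure ZFSet.{u} where
  funMap f := nomatch f
  RelMap | .mem => fun x => x 0 ∈ x 1

/-- Every class `M` of sets is a first-order structure `(M, ∈)` under true membership. -/
instance instStructureClass (M : Set ZFSet.{u}) : setLang.Structure M where
  funMap f := nomatch f
  RelMap | .mem => fun x => (x 0 : ZFSet.{u}) ∈ (x 1 : ZFSet.{u})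

/-- A definable elementary embedding `j : V → M` into some transitive model `M`.
Definability is first-order definability over `(V, ∈)` with set parameters. Elementarity is with
respect to all first-order formulas in the language `{∈}`; so `M` satisfies all the
axioms of ZFC, as `V` does. -/
structure DefinableEmbedding where
  /-- The target class. -/
  M : Set ZFSet.{u}
  transitive : ∀ x ∈ M, ∀ y ∈ x, y ∈ M
  definable_M : Set.univ.Definable₁ setLang M
  /-- The embedding, elementary as a map from `(V, ∈)` to `(M, ∈)`. -/
  toElem : ZFSet.{u} ↪ₑ[setLang] M
  /-- The graph `{(x, y) | j x = y}` is a definable class. -/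
  definable_graph : Set.univ.Definable₂ setLang
    {p : ZFSet.{u} × ZFSet.{u} | (toElem p.1 : ZFSet.{u}) = p.2}

namespace DefinableEmbedding

/-- The value `j x`, as an element of `V`. -/
def app (j : DefinableEmbedding.{u}) (x : ZFSet.{u}) : ZFSet.{u} := (j.toElem x : ZFSet.{u})

/-- `γ` is the critical point of `j`, the least ordinal moved by `j`. Here `α.toZFSet` is the
von Neumann ordinal `α` as an element of `V`. -/
def IsCrit (j : DefinableEmbedding.{u}) (γ : Ordinal.{u}) : Prop :=
  IsLeast {α : Ordinal.{u} | j.app α.toZFSet ≠ α.toZFSet} γ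

/-- `sup (j '' o) < j o`, for an ordinal `o`: the least upper bound `β` of the ordinals `j α` with
`α < o` is an element of the ordinal `j o`. -/
def SupImageLT (j : DefinableEmbedding.{u}) (o : Ordinal.{u}) : Prop :=
  ∃ β : Ordinal.{u},
    IsLUB {γ : Ordinal.{u} | ∃ α < o, j.app α.toZFSet = γ.toZFSet} β ∧
      β.toZFSet ∈ j.app o.toZFSet

end DefinableEmbedding

end StronglyCompact

/-! ### The Ketonen order and uniform ultrafilters. -/

namespace StronglyCompact

open Filter

/-! The common currency is a `δ`-complete ultrafilter on a regular `l ≥ κ` containing all final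
segments.

From an embedding `j` discontinuous at `l`, such an ultrafilter is `{X | β ∈ j X}` with `β = sup (j
'' l)`; it is `δ`-complete because `δ ≤ crit j` (`DefinableEmbedding.exists_isTailComplete`). To
return to strong compactness, Ketonen's argument takes one minimal in the Ketonen order: regressive
functions are bounded almost everywhere, and almost every point has cofinality below `κ`. This
yields small sets `x i ⊆ l` with every `k` in almost every `x i` (`exists_fine`). If the members of
a `κ`-complete filter are indexed in `l`, choosing a point in the intersection of those indexed by
`x i` pushes the ultrafilter forward to an extension of the filter.

Conversely, strong compactness extends a product of two cocardinal filters to a `δ`-complete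
ultrafilter, whose collapsed ultrapower is the embedding: one factor bounds the critical point by
`κ`, the other makes `j` discontinuous at `l`. -/

/-- A `δ`-complete ultrafilter on a linear order that contains all final segments. -/
structure IsTailComplete {I : Type u} [LinearOrder I] (δ : Cardinal.{u}) (U : Ultrafilter I) :
    Prop where
  complete : CardinalInterFilter (U : Filter I) δ
  tail : ∀ i, ∀ᶠ k in (U : Filter I), i < k

theorem cardinalInterFilter_pure {A : Type u} (δ : Cardinal.{u}) (a : A) :
    CardinalInterFilter ((pure a : Ultrafilter A) : Filter A) δ :=
  ⟨fun S _ hS => by simpa using hS⟩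

theorem mem_ultrafilter_bind {A B : Type u} {U : Ultrafilter A} {W : A → Ultrafilter B}
    {s : Set B} : s ∈ U.bind W ↔ ∀ᶠ a in (U : Filter A), s ∈ W a :=
  Filter.mem_bind'

theorem cardinalInterFilter_bind {A B : Type u} {δ : Cardinal.{u}} {U : Ultrafilter A}
    {W : A → Ultrafilter B} (hU : CardinalInterFilter (U : Filter A) δ)
    (hW : ∀ a, CardinalInterFilter (W a : Filter B) δ) :
    CardinalInterFilter (U.bind W : Filter B) δ := by
  refine ⟨fun S hS h => ?_⟩
  change _ ∈ U.bind W
  have h' : ∀ᶠ a in (U : Filter A), ∀ s ∈ S, s ∈ W a :=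
    (eventually_cardinal_ball hS).2 fun s hs => mem_ultrafilter_bind.1 (h s hs)
  rw [mem_ultrafilter_bind]
  filter_upwards [h'] with a ha
  exact (hW a).cardinal_sInter_mem S hS ha

/-- The Ketonen order on countably complete ultrafilters on a well-order: `U' < U` if `U'` is the
`U`-limit of ultrafilters `W i`, with `W i` concentrating on the predecessors of `i`. -/
def KetonenLT {I : Type u} [LinearOrder I] (U' U : Ultrafilter I) : Prop :=
  CountableInterFilter (U : Filter I) ∧ ∃ W : I → Ultrafilter I,
    (∀ i, CountableInterFilter (W i : Filter I)) ∧
    (∀ᶠ i in (U : Filter I), Set.Iio i ∈ W i) ∧ U' = U.bind W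

theorem wellFounded_ketonenLT (I : Type u) [LinearOrder I] [WellFoundedLT I] :
    WellFounded (KetonenLT (I := I)) := by
  rw [wellFounded_iff_isEmpty_descending_chain]
  refine ⟨fun ⟨U, hU⟩ => ?_⟩
  have hc : ∀ n, CountableInterFilter (U n : Filter I) := fun n => (hU n).1
  choose W hWc hW hWU using fun n => (hU n).2
  -- `G n k` collects the points from which the descent through `W k, W (k + 1), …` can be continued
  -- for `n + 1` stages. A point in all `G n k` has, by countable completeness, a smaller point in
  -- all `G n (k + 1)`.
  let G : ℕ → ℕ → Set I := fun n => Nat.rec (motive := fun _ => ℕ → Set I)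
    (fun k => {i | Set.Iio i ∈ W k i}) (fun _ g k => {i | Set.Iio i ∈ W k i ∧ g (k + 1) ∈ W k i}) n
  have hG : ∀ n k, G n k ∈ U k := by
    intro n
    induction n with
    | zero => exact hW
    | succ n ih =>
      intro k
      have h1 := ih (k + 1)
      rw [hWU k, mem_ultrafilter_bind] at h1
      exact (hW k).and h1
  have key : ∀ i k, ¬ ∀ n, i ∈ G n k := by
    intro i
    induction i using WellFoundedLT.induction with
    | _ i ih =>
      intro k hi
      have h1 : ∀ᶠ x in (W k i : Filter I), ∀ n, x ∈ G n (k + 1) :=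
        eventually_countable_forall.2 fun n => (hi (n + 1)).2
      have h2 : ∀ᶠ x in (W k i : Filter I), x < i := hi 0
      obtain ⟨x, hx, hxi⟩ := (h1.and h2).exists
      exact ih x hxi (k + 1) hx
  have h0 : ∀ᶠ x in (U 0 : Filter I), ∀ n, x ∈ G n 0 :=
    eventually_countable_forall.2 fun n => hG n 0
  obtain ⟨x, hx⟩ := h0.exists
  exact key x 0 hx

/-- A Ketonen-minimal `U` works. An unbounded regressive `f` would make the image of `U` under `f`
smaller; local ultrafilters unbounded below almost every `i` would have a smaller `U`-limit. -/
theorem exists_isTailComplete_minimal {I : Type u} [LinearOrder I] [WellFoundedLT I]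
    {δ : Cardinal.{u}} (hδ : ℵ₀ < δ) (h : ∃ U : Ultrafilter I, IsTailComplete δ U) :
    ∃ U : Ultrafilter I, IsTailComplete δ U ∧
      (∀ f : I → I, (∀ᶠ i in (U : Filter I), f i < i) →
        ∃ b, ∀ᶠ i in (U : Filter I), f i ≤ b) ∧
      ∀ᶠ i in (U : Filter I), ¬ ∃ W : Ultrafilter I, CardinalInterFilter (W : Filter I) δ ∧
        Set.Iio i ∈ W ∧ ∀ k < i, Set.Ioi k ∈ W := by
  obtain ⟨U, hU, hmin⟩ := (wellFounded_ketonenLT I).has_min {U | IsTailComplete δ U} h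
  have hUc := hU.complete
  have hmin' : ∀ W : I → Ultrafilter I, (∀ i, CardinalInterFilter (W i : Filter I) δ) →
      (∀ᶠ i in (U : Filter I), Set.Iio i ∈ W i) → ¬ IsTailComplete δ (U.bind W) :=
    fun W hW h1 h2 => hmin _ h2 ⟨CardinalInterFilter.toCountableInterFilter _ hδ, W,
      fun i => haveI := hW i; CardinalInterFilter.toCountableInterFilter _ hδ, h1, rfl⟩
  refine ⟨U, hU, fun f hf => ?_, ?_⟩
  · by_contra hb
    have hb : ∀ b, ∀ᶠ i in (U : Filter I), b < f i := fun b => by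
      simpa using Ultrafilter.eventually_not.2 (not_exists.1 hb b)
    refine hmin' (fun i => pure (f i)) (fun i => cardinalInterFilter_pure δ _) ?_
      ⟨cardinalInterFilter_bind hUc fun i => cardinalInterFilter_pure δ _, fun i => ?_⟩
    · simpa using hf
    · refine mem_ultrafilter_bind.2 ?_
      simpa using hb i
  · by_contra hB
    have hB := Ultrafilter.frequently_iff_eventually.1 hB
    let P : I → Ultrafilter I → Prop := fun i W => CardinalInterFilter (W : Filter I) δ ∧
        Set.Iio i ∈ W ∧ ∀ k < i, Set.Ioi k ∈ W
    have hex : ∀ i, ∃ W : Ultrafilter I, CardinalInterFilter (W : Filter I) δ ∧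
        ((∃ W, P i W) → P i W) := by
      intro i
      by_cases h : ∃ W, P i W
      · obtain ⟨W, hW⟩ := h
        exact ⟨W, hW.1, fun _ => hW⟩
      · exact ⟨pure i, cardinalInterFilter_pure δ i, fun h' => (h h').elim⟩
    choose W hWc hW using hex
    refine hmin' W hWc (hB.mono fun i hi => (hW i hi).2.1)
      ⟨cardinalInterFilter_bind hUc hWc, fun i => mem_ultrafilter_bind.2 ?_⟩
    filter_upwards [hB, hU.tail i] with k hk hik
    exact (hW k hk).2.2 i hik

/-- If the cofinality of `i` were at least `κ`, it would be regular, and the ultrafilter that `H`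
gives there, pushed along a cofinal sequence, would contradict `hi`. -/
theorem exists_small_cofinal {I : Type u} [LinearOrder I] [WellFoundedLT I] {δ κ : Cardinal.{u}}
    (hκ : ℵ₀ ≤ κ)
    (H : ∀ l : Cardinal.{u}, l.IsRegular → κ ≤ l →
      ∃ U : Ultrafilter l.ord.ToType, IsTailComplete δ U) (i : I)
    (hi : ¬ ∃ W : Ultrafilter I, CardinalInterFilter (W : Filter I) δ ∧
        Set.Iio i ∈ W ∧ ∀ k < i, Set.Ioi k ∈ W) :
    ∃ s : Set I, #s < κ ∧ (∀ m ∈ s, m < i) ∧ ∀ k < i, ∃ m ∈ s, k ≤ m := by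
  obtain ⟨s, hs, hst⟩ := Ordinal.exists_ord_cof_eq (Set.Iio i)
  set μ := Order.cof (Set.Iio i) with hμ
  have hcard : #s = μ := by
    have := congrArg Ordinal.card hst
    simpa using this
  by_cases hlt : μ < κ
  · refine ⟨Subtype.val '' s, mk_image_le.trans_lt (hcard ▸ hlt), ?_, fun k hk => ?_⟩
    · rintro _ ⟨m, -, rfl⟩
      exact m.2
    · obtain ⟨m, hm, hkm⟩ := hs ⟨k, hk⟩
      exact ⟨m, ⟨m, hm, rfl⟩, hkm⟩
  · exfalso
    rw [not_lt] at hlt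
    have hreg : μ.IsRegular := ⟨hκ.trans hlt, (Order.cof_ord_cof (Set.Iio i)).ge⟩
    obtain ⟨U, hU⟩ := H μ hreg hlt
    obtain ⟨e⟩ := Ordinal.type_eq.1 ((Ordinal.type_toType μ.ord).trans hst.symm)
    let g : μ.ord.ToType → I := fun x => (e x).1.1
    have hUc := hU.complete
    refine hi ⟨U.map g, inferInstanceAs (CardinalInterFilter (Filter.map g U) δ), ?_, ?_⟩
    · change ∀ᶠ x in (U : Filter μ.ord.ToType), g x < i
      exact Filter.Eventually.of_forall fun x => (e x).1.2
    · intro k hk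
      obtain ⟨m, hm, hkm⟩ := hs ⟨k, hk⟩
      change ∀ᶠ x in (U : Filter μ.ord.ToType), k < g x
      filter_upwards [hU.tail (e.symm ⟨m, hm⟩)] with x hx
      have hx' : (⟨m, hm⟩ : s) < e x := by
        have := e.map_rel_iff.2 hx
        simpa using this
      exact lt_of_le_of_lt (show k ≤ m.1 from hkm) hx'

/-- Small cofinal sets `c i` almost always meet an interval `[k, g k]`, by boundedness of regressive
functions. Regularity of `l` gives `l` many disjoint such intervals; `x i` indexes those that `c i`
meets, so it is no larger than `c i`. -/
theorem exists_fine {δ κ l : Cardinal.{u}} (hδ : ℵ₀ < δ) (hκ : ℵ₀ ≤ κ)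
    (H : ∀ l : Cardinal.{u}, l.IsRegular → κ ≤ l →
      ∃ U : Ultrafilter l.ord.ToType, IsTailComplete δ U) (hl : l.IsRegular) (hκl : κ ≤ l) :
    ∃ (U : Ultrafilter l.ord.ToType) (x : l.ord.ToType → Set l.ord.ToType),
      CardinalInterFilter (U : Filter l.ord.ToType) δ ∧ (∀ i, #(x i) < κ) ∧
        ∀ k, ∀ᶠ i in (U : Filter l.ord.ToType), k ∈ x i := by
  obtain ⟨U, hU, hnormal, hno⟩ := exists_isTailComplete_minimal hδ (H l hl hκl)
  let I := l.ord.ToType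
  have hex : ∀ i : I, ∃ s : Set I, #s < κ ∧ ((¬ ∃ W : Ultrafilter I,
      CardinalInterFilter (W : Filter I) δ ∧ Set.Iio i ∈ W ∧ ∀ k < i, Set.Ioi k ∈ W) →
      (∀ m ∈ s, m < i) ∧ ∀ k < i, ∃ m ∈ s, k ≤ m) := by
    intro i
    by_cases h : ∃ W : Ultrafilter I, CardinalInterFilter (W : Filter I) δ ∧
      Set.Iio i ∈ W ∧ ∀ k < i, Set.Ioi k ∈ W
    · exact ⟨∅, by simpa using aleph0_pos.trans_le hκ, fun h' => (h' h).elim⟩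
    · obtain ⟨s, h1, h2⟩ := exists_small_cofinal hκ H i h
      exact ⟨s, h1, fun _ => h2⟩
  choose c hcκ hc using hex
  have hg : ∀ k : I, ∃ b, ∀ᶠ i in (U : Filter I), ∃ m ∈ c i, k ≤ m ∧ m ≤ b := by
    intro k
    have h1 : ∀ᶠ i in (U : Filter I), ∃ m ∈ c i, k ≤ m ∧ m < i := by
      filter_upwards [hno, hU.tail k] with i hi hki
      obtain ⟨m, hm, hkm⟩ := (hc i hi).2 k hki
      exact ⟨m, hm, hkm, (hc i hi).1 m hm⟩
    have : Nonempty I := ⟨k⟩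
    choose! f hf using fun i (h : ∃ m ∈ c i, k ≤ m ∧ m < i) => h
    obtain ⟨b, hb⟩ := hnormal f (h1.mono fun i hi => (hf i hi).2.2)
    refine ⟨b, ?_⟩
    filter_upwards [h1, hb] with i hi hib
    exact ⟨f i, (hf i hi).1, (hf i hi).2.1, hib⟩
  choose g hg using hg
  have hbdd : ∀ (k : I) (η : Set.Iio k → I), ∃ b, ∀ z, g (η z) < b := by
    intro k η
    have : ¬ IsCofinal (Set.range fun z => g (η z)) := fun hcof => by
      have h1 := (Order.cof_le hcof).trans mk_range_le
      rw [Ordinal.cof_toType, hl.cof_ord] at h1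
      exact not_lt_of_ge h1 ((mk_Iio_lt k (by rw [mk_ord_toType, Ordinal.type_toType])).trans_eq (mk_ord_toType l))
    obtain ⟨b, hb⟩ := not_isCofinal_iff.1 this
    exact ⟨b, fun z => hb _ ⟨z, rfl⟩⟩
  choose step hstep using hbdd
  let η : I → I := (wellFounded_lt (α := I)).fix fun k rec => step k fun z => rec z.1 z.2
  have hη : ∀ z k : I, z < k → g (η z) < η k := by
    intro z k hzk
    have : η k = step k fun z => η z.1 := (wellFounded_lt (α := I)).fix_eq _ k
    rw [this]
    exact hstep k (fun z => η z.1) ⟨z, hzk⟩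
  refine ⟨U, fun i => {k | ∃ m ∈ c i, η k ≤ m ∧ m ≤ g (η k)}, hU.complete, fun i => ?_,
    fun k => hg (η k)⟩
  choose f hf using fun k : {k | ∃ m ∈ c i, η k ≤ m ∧ m ≤ g (η k)} => k.2
  refine (mk_le_of_injective (f := fun k => (⟨f k, (hf k).1⟩ : c i)) fun a b hab => ?_).trans_lt
    (hcκ i)
  have hab : f a = f b := congrArg Subtype.val hab
  rcases lt_trichotomy a.1 b.1 with h | h | h
  · exact absurd (((hf b).2.1.trans_eq hab.symm).trans (hf a).2.2) (hη _ _ h).not_ge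
  · exact Subtype.ext h
  · exact absurd (((hf a).2.1.trans_eq hab).trans (hf b).2.2) (hη _ _ h).not_ge

/-- If every regular cardinal `l ≥ κ` carries a uniform `δ`-complete ultrafilter, then `κ` is
`δ`-strongly compact. -/
theorem isStronglyCompact_of_isTailComplete {δ κ : Cardinal.{u}} (hδ : ℵ₀ < δ) (hκ : ℵ₀ ≤ κ)
    (H : ∀ l : Cardinal.{u}, l.IsRegular → κ ≤ l →
      ∃ U : Ultrafilter l.ord.ToType, IsTailComplete δ U) :
    IsStronglyCompact δ κ := by
  intro A F hF hFκ
  -- The successor of `max κ #F.sets` is regular, at least `κ`, and large enough to index the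
  -- members of `F`.
  have hm : ℵ₀ ≤ max κ #F.sets := hκ.trans (le_max_left _ _)
  have hκl : κ ≤ Order.succ (max κ #F.sets) := (le_max_left _ _).trans (Order.le_succ _)
  obtain ⟨U, x, hU, hx, hfine⟩ := exists_fine hδ hκ H (isRegular_succ hm) hκl
  have hle : #F.sets ≤ #(Order.succ (max κ #F.sets)).ord.ToType := by
    rw [mk_ord_toType]
    exact (le_max_right _ _).trans (Order.le_succ _)
  obtain ⟨e⟩ := hle
  have hne : ∀ i, (⋂₀ (Subtype.val '' (e ⁻¹' x i))).Nonempty := fun i => by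
    refine nonempty_of_mem (hFκ.cardinal_sInter_mem _ (mk_image_le.trans_lt
      ((mk_preimage_of_injective _ _ e.injective).trans_lt (hx i))) ?_)
    rintro _ ⟨s, -, rfl⟩
    exact s.2
  choose h hh using hne
  refine ⟨U.map h, fun s hs => ?_, inferInstanceAs (CardinalInterFilter (Filter.map h U) δ)⟩
  change h ⁻¹' s ∈ (U : Filter _)
  filter_upwards [hfine (e ⟨s, hs⟩)] with i hi
  exact hh i s ⟨⟨s, hs⟩, hi, rfl⟩

end StronglyCompact

/-! ### First-order predicates and transfer along embeddings. -/

namespace StronglyCompact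

open FirstOrder FirstOrder.Language

/-- The membership symbol. -/
def memSymb : setLang.Relations 2 := MemRel.mem

/-- The interpretation of the membership symbol in a structure. -/
def Mem {N : Type (u + 1)} [setLang.Structure N] (a b : N) : Prop :=
  Structure.RelMap memSymb ![a, b]

theorem mem_V {a b : ZFSet.{u}} : Mem a b ↔ a ∈ b := Iff.rfl

/-- A predicate on valuations, given for all structures at once, is first-order if it is expressed
by a single formula. -/
def IsFirstOrder {α : Type} (P : ∀ (N : Type (u + 1)) [setLang.Structure N], (α → N) → Prop) :
    Prop :=
  ∃ φ : setLang.Formula α, ∀ (N : Type (u + 1)) [setLang.Structure N] (v : α → N),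
    φ.Realize v ↔ P N v

namespace IsFirstOrder

variable {α : Type}

theorem mem (a b : α) : IsFirstOrder.{u} fun _ _ v => Mem (v a) (v b) := by
  refine ⟨memSymb.formula ![.var a, .var b], fun N _ v => ?_⟩
  rw [Formula.realize_rel]
  have : (fun i => Term.realize v ((![.var a, .var b] : Fin 2 → setLang.Term α) i)) =
      ![v a, v b] := by
    funext i
    fin_cases i <;> rfl
  rw [this]
  rfl

theorem eq (a b : α) : IsFirstOrder.{u} fun _ _ v => v a = v b :=
  ⟨Term.equal (.var a) (.var b), fun N _ v => by simp⟩

theorem not {P : ∀ (N : Type (u + 1)) [setLang.Structure N], (α → N) → Prop}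
    (hP : IsFirstOrder P) : IsFirstOrder fun N _ v => ¬ P N v := by
  obtain ⟨φ, hφ⟩ := hP
  exact ⟨φ.not, fun N _ v => by rw [Formula.realize_not, hφ]⟩

theorem imp {P Q : ∀ (N : Type (u + 1)) [setLang.Structure N], (α → N) → Prop}
    (hP : IsFirstOrder P) (hQ : IsFirstOrder Q) : IsFirstOrder fun N _ v => P N v → Q N v := by
  obtain ⟨φ, hφ⟩ := hP
  obtain ⟨ψ, hψ⟩ := hQ
  exact ⟨φ.imp ψ, fun N _ v => by rw [Formula.realize_imp, hφ, hψ]⟩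

theorem and {P Q : ∀ (N : Type (u + 1)) [setLang.Structure N], (α → N) → Prop}
    (hP : IsFirstOrder P) (hQ : IsFirstOrder Q) : IsFirstOrder fun N _ v => P N v ∧ Q N v := by
  obtain ⟨φ, hφ⟩ := hP
  obtain ⟨ψ, hψ⟩ := hQ
  exact ⟨φ ⊓ ψ, fun N _ v => by rw [Formula.realize_inf, hφ, hψ]⟩

theorem or {P Q : ∀ (N : Type (u + 1)) [setLang.Structure N], (α → N) → Prop}
    (hP : IsFirstOrder P) (hQ : IsFirstOrder Q) : IsFirstOrder fun N _ v => P N v ∨ Q N v := by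
  obtain ⟨φ, hφ⟩ := hP
  obtain ⟨ψ, hψ⟩ := hQ
  exact ⟨φ ⊔ ψ, fun N _ v => by rw [Formula.realize_sup, hφ, hψ]⟩

theorem iff {P Q : ∀ (N : Type (u + 1)) [setLang.Structure N], (α → N) → Prop}
    (hP : IsFirstOrder P) (hQ : IsFirstOrder Q) : IsFirstOrder fun N _ v => (P N v ↔ Q N v) := by
  obtain ⟨φ, hφ⟩ := hP
  obtain ⟨ψ, hψ⟩ := hQ
  exact ⟨φ.iff ψ, fun N _ v => by rw [Formula.realize_iff, hφ, hψ]⟩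

theorem ex {P : ∀ (N : Type (u + 1)) [setLang.Structure N], (α → N) → N → Prop}
    (hP : IsFirstOrder (α := Option α) fun N _ v => P N (fun a => v (some a)) (v none)) :
    IsFirstOrder fun N _ v => ∃ x, P N v x := by
  obtain ⟨φ, hφ⟩ := hP
  let g : Option α → α ⊕ Unit := fun o => o.elim (Sum.inr ()) Sum.inl
  refine ⟨(φ.relabel g).iExs Unit, fun N _ v => ?_⟩
  simp only [Formula.realize_iExs, Formula.realize_relabel, hφ]
  exact ⟨fun ⟨x, hx⟩ => ⟨x (), hx⟩, fun ⟨x, hx⟩ => ⟨fun _ => x, hx⟩⟩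

theorem all {P : ∀ (N : Type (u + 1)) [setLang.Structure N], (α → N) → N → Prop}
    (hP : IsFirstOrder (α := Option α) fun N _ v => P N (fun a => v (some a)) (v none)) :
    IsFirstOrder fun N _ v => ∀ x, P N v x := by
  obtain ⟨φ, hφ⟩ := (ex (P := fun N _ v x => ¬ P N v x) hP.not).not
  refine ⟨φ, fun N _ v => ?_⟩
  rw [hφ]
  push Not
  rfl

end IsFirstOrder

/-- `p` is the Kuratowski pair of `x` and `y`. -/
def IsPair {N : Type (u + 1)} [setLang.Structure N] (p x y : N) : Prop :=
  ∃ a, (∀ z, Mem z a ↔ z = x) ∧ ∃ b, (∀ z, Mem z b ↔ z = x ∨ z = y) ∧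
    ∀ z, Mem z p ↔ z = a ∨ z = b

/-- The pair of `x` and `y` is an element of `R`. -/
def Related {N : Type (u + 1)} [setLang.Structure N] (R x y : N) : Prop :=
  ∃ p, Mem p R ∧ IsPair p x y

theorem IsFirstOrder.isPair {α : Type} (p x y : α) :
    IsFirstOrder.{u} fun _ _ v => IsPair (v p) (v x) (v y) := by
  unfold IsPair
  exact .ex (.and (.all (.iff (.mem _ _) (.eq _ _))) (.ex (.and
    (.all (.iff (.mem _ _) (.or (.eq _ _) (.eq _ _))))
    (.all (.iff (.mem _ _) (.or (.eq _ _) (.eq _ _)))))))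

theorem IsFirstOrder.related {α : Type} (R x y : α) :
    IsFirstOrder.{u} fun _ _ v => Related (v R) (v x) (v y) := by
  unfold Related
  exact .ex (.and (.mem _ _) (.isPair _ _ _))

theorem isPair_iff {p x y : ZFSet.{u}} : IsPair p x y ↔ p = ZFSet.pair x y := by
  simp only [IsPair, mem_V]
  constructor
  · rintro ⟨a, ha, b, hb, hp⟩
    have ha' : a = {x} := ZFSet.ext fun z => by simp [ha]
    have hb' : b = {x, y} := ZFSet.ext fun z => by simp [hb]
    exact ZFSet.ext fun z => by simp [hp, ha', hb', ZFSet.pair]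
  · rintro rfl
    exact ⟨{x}, by simp, {x, y}, by simp, by simp [ZFSet.pair]⟩

theorem related_iff {R x y : ZFSet.{u}} : Related R x y ↔ ZFSet.pair x y ∈ R := by
  simp [Related, isPair_iff, mem_V]

namespace DefinableEmbedding

variable (j : DefinableEmbedding.{u})

theorem transfer {α : Type} {P : ∀ (N : Type (u + 1)) [setLang.Structure N], (α → N) → Prop}
    (hP : IsFirstOrder P) (v : α → ZFSet.{u}) : P j.M (j.toElem ∘ v) ↔ P ZFSet.{u} v := by
  obtain ⟨φ, hφ⟩ := hP
  rw [← hφ, ← hφ, j.toElem.map_formula]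

theorem app_mem_app {x y : ZFSet.{u}} : j.app x ∈ j.app y ↔ x ∈ y :=
  j.transfer (α := Fin 2) (.mem 0 1) ![x, y]

/-- Elementarity gives the statement inside `M`; transitivity puts every set it concerns into `M`.
-/
theorem app_isOrdinal {x : ZFSet.{u}} (hx : x.IsOrdinal) : (j.app x).IsOrdinal := by
  have h := j.transfer (α := Fin 1) (P := fun N _ v =>
    (∀ y, Mem y (v 0) → ∀ z, Mem z y → Mem z (v 0)) ∧
    ∀ y z w, Mem y z → Mem z w → Mem w (v 0) → Mem y w)
    (.and (.all (.imp (.mem _ _) (.all (.imp (.mem _ _) (.mem _ _)))))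
      (.all (.all (.all (.imp (.mem _ _) (.imp (.mem _ _) (.imp (.mem _ _) (.mem _ _)))))))) ![x]
  obtain ⟨h1, h2⟩ := h.2 ⟨fun y hy z hz => hx.isTransitive y hy hz,
    fun y z w h1 h2 h3 => hx.mem_trans' h1 h2 h3⟩
  have hM : ∀ y ∈ j.app x, y ∈ j.M := j.transitive _ (j.toElem x).2
  refine ⟨fun y hy z hz => ?_, fun {y z w} hyz hzw hw => ?_⟩
  · exact h1 ⟨y, hM y hy⟩ hy ⟨z, j.transitive _ (hM y hy) z hz⟩ hz
  · have hwM := hM w hw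
    have hzM := j.transitive _ hwM z hzw
    exact h2 ⟨y, j.transitive _ hzM y hyz⟩ ⟨z, hzM⟩ ⟨w, hwM⟩ hyz hzw hw

theorem exists_app_toZFSet_eq (o : Ordinal.{u}) :
    ∃ o' : Ordinal.{u}, j.app o.toZFSet = o'.toZFSet := by
  obtain ⟨o', h⟩ := ZFSet.isOrdinal_iff_mem_range_toZFSet.1
    (j.app_isOrdinal (ZFSet.isOrdinal_toZFSet o))
  exact ⟨o', h.symm⟩

end DefinableEmbedding

/-! ### The ultrafilter derived from an embedding. -/

section Code

variable {o : Ordinal.{u}}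

/-- The element `i` of the canonical well-order of type `o`, as a von Neumann ordinal. -/
noncomputable def elt (i : o.ToType) : ZFSet.{u} := (i.toOrd : Ordinal.{u}).toZFSet

theorem elt_injective : Function.Injective (elt (o := o)) := fun _ _ h =>
  Ordinal.ToType.mk.symm.injective (Subtype.ext (Ordinal.toZFSet_injective h))

theorem mem_toZFSet_iff_elt {z : ZFSet.{u}} : z ∈ o.toZFSet ↔ ∃ i : o.ToType, elt i = z := by
  rw [Ordinal.mem_toZFSet_iff]
  constructor
  · rintro ⟨a, ha, rfl⟩
    exact ⟨Ordinal.ToType.mk ⟨a, ha⟩, by simp [elt, Ordinal.ToType.toOrd]⟩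
  · rintro ⟨i, rfl⟩
    exact ⟨_, i.toOrd.2, rfl⟩

/-- A set of elements of the canonical well-order of type `o`, as a set of ordinals. -/
noncomputable def code (X : Set o.ToType) : ZFSet.{u} := ZFSet.range fun i : X => elt i.1

theorem mem_code {X : Set o.ToType} {z : ZFSet.{u}} : z ∈ code X ↔ ∃ i ∈ X, elt i = z := by
  simp [code]

theorem elt_mem_code {X : Set o.ToType} {i : o.ToType} : elt i ∈ code X ↔ i ∈ X := by
  rw [mem_code]
  exact ⟨fun ⟨k, hk, h⟩ => elt_injective h ▸ hk, fun h => ⟨i, h, rfl⟩⟩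

end Code

/-- The ultrafilter derived from `j` and a point of `j l` above `j '' l`. -/
theorem DefinableEmbedding.exists_isTailComplete (j : DefinableEmbedding.{u}) {δ l : Cardinal.{u}}
    {γ : Ordinal.{u}} (hδ : ℵ₀ < δ) (hl : ℵ₀ ≤ l) (hγ : j.IsCrit γ) (hδγ : δ.ord ≤ γ)
    (hj : j.SupImageLT l.ord) : ∃ U : Ultrafilter l.ord.ToType, IsTailComplete δ U := by
  obtain ⟨β, hβ, hβl⟩ := hj
  set b := β.toZFSet with hb
  have hbM : b ∈ j.M := j.transitive _ (j.toElem _).2 b hβl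
  let L : Set (Set l.ord.ToType) := {X | b ∈ j.app (code X)}
  have hmono : ∀ s t, s ∈ L → s ⊆ t → t ∈ L := fun s t hs hst => by
    have h := (j.transfer (α := Fin 2) (P := fun N _ v => ∀ x, Mem x (v 0) → Mem x (v 1))
      (.all (.imp (.mem _ _) (.mem _ _))) ![code s, code t]).2 fun x hx => by
        obtain ⟨i, hi, rfl⟩ := mem_code.1 hx
        exact elt_mem_code.2 (hst hi)
    exact h ⟨b, hbM⟩ hs
  have hcompl : ∀ s, sᶜ ∉ L ↔ s ∈ L := fun s => by
    have h := (j.transfer (α := Fin 3) (P := fun N _ v => ∀ x, Mem x (v 2) →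
      (¬ Mem x (v 1) ↔ Mem x (v 0))) (.all (.imp (.mem _ _) (.iff (.not (.mem _ _)) (.mem _ _))))
      ![code s, code sᶜ, l.ord.toZFSet]).2 fun x hx => by
        obtain ⟨i, rfl⟩ := mem_toZFSet_iff_elt.1 hx
        change ¬ elt i ∈ code sᶜ ↔ elt i ∈ code s
        simp [elt_mem_code]
    exact h ⟨b, hbM⟩ hβl
  have hInter : ∀ S : Set (Set l.ord.ToType), #S < δ → S ⊆ L → ⋂₀ S ∈ L := by
    intro S hS hSL
    obtain ⟨e⟩ : Nonempty ((#S).ord.ToType ≃ S) := by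
      rw [← Cardinal.eq, mk_ord_toType]
    -- `R` codes the family `S` indexed by an ordinal below the critical point. Both that ordinal
    -- and its elements are fixed by `j`, so the sections of `j R` involve no new indices, and each
    -- contains the `j`-image of a member of `S`, hence `b`.
    let R : ZFSet.{u} := ZFSet.range
      fun p : {p : (#S).ord.ToType × l.ord.ToType // p.2 ∈ (e p.1).1} =>
        ZFSet.pair (elt p.1.1) (elt p.1.2)
    have hR : ∀ i x, ZFSet.pair (elt i) (elt x) ∈ R ↔ x ∈ (e i).1 := fun i x => by
      simp only [R, ZFSet.mem_range, ZFSet.pair_inj]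
      constructor
      · rintro ⟨p, h1, h2⟩
        rw [← elt_injective h1, ← elt_injective h2]
        exact p.2
      · exact fun h => ⟨⟨(i, x), h⟩, rfl, rfl⟩
    have h1 := (j.transfer (α := Fin 4) (P := fun N _ v => ∀ x, Mem x (v 0) →
      (∀ i, Mem i (v 1) → Related (v 2) i x) → Mem x (v 3))
      (.all (.imp (.mem _ _) (.imp (.all (.imp (.mem _ _) (.related _ _ _))) (.mem _ _))))
      ![l.ord.toZFSet, (#S).ord.toZFSet, R, code (⋂₀ S)]).2 fun x hx hxR => by
        obtain ⟨x, rfl⟩ := mem_toZFSet_iff_elt.1 hx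
        refine elt_mem_code.2 fun s hs => ?_
        have h := related_iff.1 (hxR (elt (e.symm ⟨s, hs⟩)) (mem_toZFSet_iff_elt.2 ⟨_, rfl⟩))
        simpa using (hR _ _).1 h
    have hfix : ∀ a < γ, j.app a.toZFSet = a.toZFSet := fun a ha => by
      by_contra h
      exact (hγ.2 h).not_gt ha
    have hSγ : (#S).ord < γ := (ord_lt_ord.2 hS).trans_le hδγ
    refine h1 ⟨b, hbM⟩ hβl fun ⟨i, hiM⟩ hi => ?_
    replace hi : i ∈ j.app (#S).ord.toZFSet := hi
    rw [hfix _ hSγ] at hi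
    obtain ⟨i, rfl⟩ := mem_toZFSet_iff_elt.1 hi
    have h2 := (j.transfer (α := Fin 3) (P := fun N _ v => ∀ x, Mem x (v 0) →
      Related (v 1) (v 2) x) (.all (.imp (.mem _ _) (.related _ _ _)))
      ![code (e i).1, R, elt i]).2 fun x hx => by
        obtain ⟨x, hx', rfl⟩ := mem_code.1 hx
        exact related_iff.2 ((hR i x).2 hx')
    have h3 := h2 ⟨b, hbM⟩ (hSL (e i).2)
    have hi' : j.toElem (elt i) = ⟨elt i, hiM⟩ :=
      Subtype.ext (hfix _ ((show i.toOrd.1 < _ from i.toOrd.2).trans hSγ))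
    rw [← hi']
    exact h3
  have h2δ : 2 < δ := (natCast_lt_aleph0 (n := 2)).trans hδ
  let U : Ultrafilter l.ord.ToType :=
    Ultrafilter.ofComplNotMemIff (Filter.ofCardinalInter L h2δ hInter hmono) hcompl
  refine ⟨U, ⟨hInter⟩, fun i => ?_⟩
  change b ∈ j.app (code (Set.Ioi i))
  -- The successor makes the complement of `a` in `l` exactly the strict final segment above `i`.
  let a : Ordinal.{u} := Order.succ i.toOrd.1
  have ha : a < l.ord := (isSuccLimit_ord hl).succ_lt i.toOrd.2
  obtain ⟨a', ha'⟩ := j.exists_app_toZFSet_eq a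
  have hba : b ∉ j.app a.toZFSet := by
    rw [ha', hb, Ordinal.toZFSet_mem_toZFSet_iff, not_lt]
    exact hβ.1 ⟨a, ha, ha'⟩
  have h := (j.transfer (α := Fin 3) (P := fun N _ v => ∀ x, Mem x (v 0) →
    ¬ Mem x (v 1) → Mem x (v 2)) (.all (.imp (.mem _ _) (.imp (.not (.mem _ _)) (.mem _ _))))
    ![l.ord.toZFSet, a.toZFSet, code (Set.Ioi i)]).2 fun x hx hxa => by
      obtain ⟨x, rfl⟩ := mem_toZFSet_iff_elt.1 hx
      refine elt_mem_code.2 ?_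
      have hxa : ¬ elt x ∈ a.toZFSet := hxa
      rw [elt, Ordinal.toZFSet_mem_toZFSet_iff, not_lt, Order.succ_le_iff] at hxa
      exact Ordinal.ToType.mk.symm.lt_iff_lt.1 hxa
  exact h ⟨b, hbM⟩ hβl hba

end StronglyCompact

/-! ### The collapsed ultrapower. -/

namespace StronglyCompact

open FirstOrder FirstOrder.Language Filter

theorem IsFirstOrder.definable {α : Type} {β : Type*}
    {P : ∀ (N : Type (u + 1)) [setLang.Structure N], (α → N) → Prop} (hP : IsFirstOrder P)
    (p : α → ZFSet.{u} ⊕ β) :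
    Set.univ.Definable setLang {v : β → ZFSet.{u} | P ZFSet.{u} fun a => Sum.elim id v (p a)} := by
  obtain ⟨φ, hφ⟩ := hP
  refine Set.definable_iff_exists_formula_sum.2
    ⟨φ.relabel fun a => (p a).map (fun x => ⟨x, Set.mem_univ x⟩) id, ?_⟩
  ext v
  simp only [Set.mem_ofPred_eq, Formula.realize_relabel, hφ]
  refine iff_of_eq (congrArg _ (funext fun a => ?_))
  rcases h : p a with x | b <;> simp [h]

section Collapse

variable {A : Type u} (U : Ultrafilter A)

/-- Membership of functions modulo an ultrafilter. -/
def MemMod (g f : A → ZFSet.{u}) : Prop := ∀ᶠ a in (U : Filter A), g a ∈ f a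

variable {U}

theorem wellFounded_memMod (hU : CountableInterFilter (U : Filter A)) :
    WellFounded (MemMod U) := by
  rw [wellFounded_iff_isEmpty_descending_chain]
  refine ⟨fun ⟨f, hf⟩ => ?_⟩
  obtain ⟨a, ha⟩ := (eventually_countable_forall.2 hf).exists
  exact (wellFounded_iff_isEmpty_descending_chain.1 ZFSet.mem_wf).false ⟨fun n => f n a, ha⟩

variable (hU : CountableInterFilter (U : Filter A))

/-- The Mostowski collapse of the ultrapower of the universe, as a map on representatives. -/
noncomputable def collapse : (A → ZFSet.{u}) → ZFSet.{u} :=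
  -- Restricting values to `insert ∅ (f a)` leaves only a set of representatives; `∅` is the default
  -- on a null set.
  (wellFounded_memMod hU).fix fun (f : A → ZFSet.{u}) rec => ZFSet.range
    fun g : {g : ∀ a, {y : ZFSet.{u} // y ∈ insert (∅ : ZFSet.{u}) (f a)} // MemMod U (fun a => (g a).1) f} =>
      rec (fun a => (g.1 a).1) g.2

theorem mem_collapse_aux {f : A → ZFSet.{u}} {z : ZFSet.{u}} :
    z ∈ collapse hU f ↔ ∃ g, (∀ a, g a ∈ insert ∅ (f a)) ∧ MemMod U g f ∧ collapse hU g = z := by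
  rw [collapse, WellFounded.fix_eq, ZFSet.mem_range]
  constructor
  · rintro ⟨g, rfl⟩
    exact ⟨_, fun a => (g.1 a).2, g.2, rfl⟩
  · rintro ⟨g, h1, h2, rfl⟩
    exact ⟨⟨fun a => ⟨g a, h1 a⟩, h2⟩, rfl⟩

theorem exists_eventuallyEq_mem_insert {g f : A → ZFSet.{u}} (h : MemMod U g f) :
    ∃ g', (∀ a, g' a ∈ insert ∅ (f a)) ∧ MemMod U g' f ∧ g =ᶠ[U] g' := by
  classical
  refine ⟨fun a => if g a ∈ f a then g a else ∅, fun a => ?_, ?_, ?_⟩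
  · by_cases h : g a ∈ f a <;> simp [h]
  · filter_upwards [h] with a ha
    simp [ha]
  · filter_upwards [h] with a ha
    simp [ha]

theorem collapse_congr {f f' : A → ZFSet.{u}} (h : f =ᶠ[U] f') :
    collapse hU f = collapse hU f' := by
  induction f using (wellFounded_memMod hU).induction generalizing f' with
  | _ f ih =>
    ext z
    rw [mem_collapse_aux, mem_collapse_aux]
    constructor
    · rintro ⟨g, -, hg, rfl⟩
      have hg' : MemMod U g f' := by
        filter_upwards [hg, h] with a h1 h2
        rwa [← h2]
      obtain ⟨g', h1, h2, h3⟩ := exists_eventuallyEq_mem_insert hg'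
      exact ⟨g', h1, h2, (ih g hg h3).symm⟩
    · rintro ⟨g, -, hg, rfl⟩
      have hg' : MemMod U g f := by
        filter_upwards [hg, h] with a h1 h2
        rwa [h2]
      obtain ⟨g', h1, h2, h3⟩ := exists_eventuallyEq_mem_insert hg'
      exact ⟨g', h1, h2, ih g' h2 h3.symm⟩

theorem mem_collapse {f : A → ZFSet.{u}} {z : ZFSet.{u}} :
    z ∈ collapse hU f ↔ ∃ g, MemMod U g f ∧ collapse hU g = z := by
  rw [mem_collapse_aux]
  constructor
  · rintro ⟨g, -, h⟩
    exact ⟨g, h⟩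
  · rintro ⟨g, h, rfl⟩
    obtain ⟨g', h1, h2, h3⟩ := exists_eventuallyEq_mem_insert h
    exact ⟨g', h1, h2, (collapse_congr hU h3).symm⟩

theorem exists_memMod_of_not_eventuallyEq {f g : A → ZFSet.{u}} (h : ¬ f =ᶠ[U] g) :
    ∃ k, (MemMod U k f ∧ ¬ MemMod U k g) ∨ (MemMod U k g ∧ ¬ MemMod U k f) := by
  have h' : ∀ᶠ a in (U : Filter A), f a ≠ g a := Ultrafilter.eventually_not.2 h
  have hex : ∀ a, ∃ x, f a ≠ g a → (x ∈ f a ∧ x ∉ g a) ∨ (x ∈ g a ∧ x ∉ f a) := fun a => by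
    by_contra! hc
    refine (hc ∅).1 (ZFSet.ext fun x => ?_)
    have := (hc x).2
    tauto
  choose k hk using hex
  refine ⟨k, ?_⟩
  have h1 := Ultrafilter.eventually_or.1 (h'.mono hk)
  refine h1.imp (fun h => ?_) (fun h => ?_)
  · exact ⟨h.mono fun _ => And.left, Ultrafilter.eventually_not.1 (h.mono fun _ => And.right)⟩
  · exact ⟨h.mono fun _ => And.left, Ultrafilter.eventually_not.1 (h.mono fun _ => And.right)⟩

theorem memMod_congr {f g f' g' : A → ZFSet.{u}} (hf : f =ᶠ[U] f') (hg : g =ᶠ[U] g') :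
    MemMod U g f ↔ MemMod U g' f' := by
  constructor <;> intro h <;> filter_upwards [h, hf, hg] with a h1 h2 h3
  · rwa [← h2, ← h3]
  · rwa [h2, h3]

theorem collapse_eq_iff {f g : A → ZFSet.{u}} :
    collapse hU f = collapse hU g ↔ f =ᶠ[U] g := by
  refine ⟨fun h => ?_, collapse_congr hU⟩
  induction f using (wellFounded_memMod hU).induction generalizing g with
  | _ f ih =>
    by_contra hne
    obtain ⟨k, ⟨h1, h2⟩ | ⟨h1, h2⟩⟩ := exists_memMod_of_not_eventuallyEq hne
    · obtain ⟨k', h3, h4⟩ := (mem_collapse hU).1 (h ▸ (mem_collapse hU).2 ⟨k, h1, rfl⟩)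
      exact h2 ((memMod_congr .rfl (ih k h1 h4.symm)).2 h3)
    · obtain ⟨k', h3, h4⟩ := (mem_collapse hU).1 (h.symm ▸ (mem_collapse hU).2 ⟨k, h1, rfl⟩)
      exact h2 ((memMod_congr .rfl (ih k' h3 h4)).1 h3)

theorem collapse_mem_collapse {f g : A → ZFSet.{u}} :
    collapse hU g ∈ collapse hU f ↔ MemMod U g f := by
  rw [mem_collapse]
  refine ⟨fun ⟨k, h1, h2⟩ => ?_, fun h => ⟨g, h, rfl⟩⟩
  exact (memMod_congr .rfl ((collapse_eq_iff hU).1 h2)).1 h1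

/-- The collapse is an isomorphism of the ultrapower with its image. -/
noncomputable def collapseEquiv :
    (U : Filter A).Product (fun _ => ZFSet.{u}) ≃[setLang] Set.range (collapse hU) where
  toEquiv := Equiv.ofBijective
    (Quotient.lift (fun f => ⟨collapse hU f, f, rfl⟩) fun f g h =>
      Subtype.ext (collapse_congr hU h)) (by
    constructor
    · rintro ⟨f⟩ ⟨g⟩ h
      exact Quotient.sound ((collapse_eq_iff hU).1 (congrArg Subtype.val h))
    · rintro ⟨_, f, rfl⟩
      exact ⟨Quotient.mk _ f, rfl⟩)
  map_fun' f := nomatch f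
  map_rel' := by
    rintro n (_ | _) x
    obtain ⟨f, hf⟩ : ∃ f : Fin 2 → A → ZFSet.{u}, x = fun i => Quotient.mk ((U : Filter A).productSetoid fun _ => ZFSet.{u}) (f i) :=
      ⟨fun i => (x i).out, funext fun i => ((x i).out_eq).symm⟩
    subst hf
    refine Iff.trans ?_ (relMap_quotient_mk' (L := setLang) _ memSymb f).symm
    exact collapse_mem_collapse hU

/-- The ultrapower embedding. -/
noncomputable def ultrapowerMap : ZFSet.{u} ↪ₑ[setLang] Set.range (collapse hU) where
  toFun x := ⟨collapse hU fun _ => x, _, rfl⟩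
  map_formula' n φ x := by
    have h := (collapseEquiv hU).toElementaryEmbedding.map_formula φ
      (fun i => Quotient.mk ((U : Filter A).productSetoid fun _ => ZFSet.{u}) fun _ : A => x i)
    refine Iff.trans h ?_
    -- Łoś's theorem, for constant functions.
    refine (Ultraproduct.realize_formula_cast (u := U) φ fun i _ => x i).trans ?_
    simp

end Collapse

/-! ### Definability of the ultrapower by set-sized approximations to the collapse. -/

section Definability

section Predicates

variable {N : Type (u + 1)} [setLang.Structure N]

/-- `G` is functional on `D`. -/
def IsFunOn (D G : N) : Prop := ∀ a, Mem a D → ∃ s, ∀ t, Related G a t ↔ t = s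

/-- The values of `H` belong to those of `G` on an element of `W`. -/
def MemOn (W H G : N) : Prop :=
  ∃ B, Mem B W ∧ ∀ a, Mem a B → ∃ s, Related H a s ∧ ∃ t, Related G a t ∧ Mem s t

/-- The values of `H` and `G` agree on an element of `W`. -/
def EqOn (W H G : N) : Prop := ∃ B, Mem B W ∧ ∀ a, Mem a B → ∃ s, Related H a s ∧ Related G a s

/-- `F` is a partial collapsing map of the ultrapower by the ultrafilter `W` on `D`. -/
def IsPartialCollapse (D W F : N) : Prop :=
  ∀ G z, Related F G z → IsFunOn D G ∧ (∀ w, Mem w z → ∃ H, Related F H w ∧ MemOn W H G) ∧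
    ∀ H, IsFunOn D H → MemOn W H G → ∃ H', ∃ w, Related F H' w ∧ EqOn W H' H ∧ Mem w z

/-- `y` belongs to the ultrapower by the ultrafilter `W` on `D`. -/
def InUltrapower (D W y : N) : Prop := ∃ F, IsPartialCollapse D W F ∧ ∃ G, Related F G y

/-- `y` is the image of `x` in the ultrapower by the ultrafilter `W` on `D`. -/
def IsUltrapowerImage (D W x y : N) : Prop :=
  ∃ F, IsPartialCollapse D W F ∧ ∃ G, Related F G y ∧
    ∃ B, Mem B W ∧ ∀ a, Mem a B → Related G a x

end Predicates

namespace IsFirstOrder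

variable {α : Type}

theorem isFunOn (D G : α) : IsFirstOrder.{u} fun _ _ v => IsFunOn (v D) (v G) := by
  unfold IsFunOn
  exact .all (.imp (.mem _ _) (.ex (.all (.iff (.related _ _ _) (.eq _ _)))))

theorem memOn (W H G : α) : IsFirstOrder.{u} fun _ _ v => MemOn (v W) (v H) (v G) := by
  unfold MemOn
  exact .ex (.and (.mem _ _) (.all (.imp (.mem _ _) (.ex (.and (.related _ _ _)
    (.ex (.and (.related _ _ _) (.mem _ _))))))))

theorem eqOn (W H G : α) : IsFirstOrder.{u} fun _ _ v => EqOn (v W) (v H) (v G) := by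
  unfold EqOn
  exact .ex (.and (.mem _ _) (.all (.imp (.mem _ _) (.ex (.and (.related _ _ _)
    (.related _ _ _))))))

theorem isPartialCollapse (D W F : α) :
    IsFirstOrder.{u} fun _ _ v => IsPartialCollapse (v D) (v W) (v F) := by
  unfold IsPartialCollapse
  exact .all (.all (.imp (.related _ _ _) (.and (.isFunOn _ _) (.and
    (.all (.imp (.mem _ _) (.ex (.and (.related _ _ _) (.memOn _ _ _)))))
    (.all (.imp (.isFunOn _ _) (.imp (.memOn _ _ _)
      (.ex (.ex (.and (.related _ _ _) (.and (.eqOn _ _ _) (.mem _ _))))))))))))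

theorem inUltrapower (D W y : α) :
    IsFirstOrder.{u} fun _ _ v => InUltrapower (v D) (v W) (v y) := by
  unfold InUltrapower
  exact .ex (.and (.isPartialCollapse _ _ _) (.ex (.related _ _ _)))

theorem isUltrapowerImage (D W x y : α) :
    IsFirstOrder.{u} fun _ _ v => IsUltrapowerImage (v D) (v W) (v x) (v y) := by
  unfold IsUltrapowerImage
  exact .ex (.and (.isPartialCollapse _ _ _) (.ex (.and (.related _ _ _)
    (.ex (.and (.mem _ _) (.all (.imp (.mem _ _) (.related _ _ _))))))))

end IsFirstOrder

variable {A : Type u}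

/-- An injection of a type into the universe of sets. -/
noncomputable def atom (a : A) : ZFSet.{u} := (embeddingToCardinal a).ord.toZFSet

theorem atom_injective : Function.Injective (atom (A := A)) := fun _ _ h =>
  embeddingToCardinal.injective (ord_injective (Ordinal.toZFSet_injective h))

/-- A subset of a type, as a set of atoms. -/
noncomputable def setCode (X : Set A) : ZFSet.{u} := ZFSet.range fun a : X => atom a.1

theorem forall_mem_setCode {X : Set A} {p : ZFSet.{u} → Prop} :
    (∀ a ∈ setCode X, p a) ↔ ∀ a ∈ X, p (atom a) := by
  simp [setCode]

/-- An ultrafilter, as an element of the universe of sets. -/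
noncomputable def ultrafilterCode (U : Ultrafilter A) : ZFSet.{u} :=
  ZFSet.range fun X : {X : Set A // X ∈ U} => setCode X.1

theorem exists_mem_ultrafilterCode {U : Ultrafilter A} {p : ZFSet.{u} → Prop} :
    (∃ B ∈ ultrafilterCode U, ∀ a ∈ B, p a) ↔ ∀ᶠ a in (U : Filter A), p (atom a) := by
  simp only [ultrafilterCode, ZFSet.mem_range]
  constructor
  · rintro ⟨_, ⟨⟨X, hX⟩, rfl⟩, h⟩
    exact mem_of_superset hX (forall_mem_setCode.1 h)
  · exact fun h => ⟨_, ⟨⟨_, h⟩, rfl⟩, forall_mem_setCode.2 fun a ha => ha⟩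

/-- The set `G` contains the graph of `g` and no other pairs over the domain of `g`. -/
def Represents (G : ZFSet.{u}) (g : A → ZFSet.{u}) : Prop :=
  ∀ a t, Related G (atom a) t ↔ t = g a

theorem exists_represents (g : A → ZFSet.{u}) : ∃ G, Represents G g := by
  refine ⟨ZFSet.range fun a => ZFSet.pair (atom a) (g a), fun a t => ?_⟩
  simp only [related_iff, ZFSet.mem_range, ZFSet.pair_inj]
  constructor
  · rintro ⟨b, hb, rfl⟩
    rw [atom_injective hb]
  · rintro rfl
    exact ⟨a, rfl, rfl⟩

theorem isFunOn_iff {G : ZFSet.{u}} :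
    IsFunOn (setCode (Set.univ : Set A)) G ↔ ∃ g : A → ZFSet.{u}, Represents G g := by
  refine Iff.trans forall_mem_setCode ?_
  simp only [Set.mem_univ, forall_true_left, Represents]
  exact Classical.skolem

variable {U : Ultrafilter A}

theorem memOn_iff {G H : ZFSet.{u}} {g h : A → ZFSet.{u}} (hG : Represents G g)
    (hH : Represents H h) : MemOn (ultrafilterCode U) H G ↔ MemMod U h g := by
  refine Iff.trans exists_mem_ultrafilterCode (eventually_congr (.of_forall fun a => ?_))
  simp [hG a, hH a, mem_V]

theorem eqOn_iff {G H : ZFSet.{u}} {g h : A → ZFSet.{u}} (hG : Represents G g)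
    (hH : Represents H h) : EqOn (ultrafilterCode U) H G ↔ h =ᶠ[U] g := by
  refine Iff.trans exists_mem_ultrafilterCode (eventually_congr (.of_forall fun a => ?_))
  simp [hG a, hH a]

variable (hU : CountableInterFilter (U : Filter A))

/-- By `∈`-induction on `z`: the closure conditions on `F` are the recursion for the collapse, up to
`U`-equality of representatives. -/
theorem IsPartialCollapse.eq_collapse {F : ZFSet.{u}}
    (hF : IsPartialCollapse (setCode (Set.univ : Set A)) (ultrafilterCode U) F)
    {z G : ZFSet.{u}} {g : A → ZFSet.{u}} (hz : Related F G z) (hG : Represents G g) :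
    z = collapse hU g := by
  induction z using ZFSet.inductionOn generalizing G g with
  | _ z ih =>
    obtain ⟨-, h1, h2⟩ := hF G z hz
    ext w
    rw [mem_collapse]
    constructor
    · intro hw
      obtain ⟨H, hHw, hHG⟩ := h1 w hw
      obtain ⟨h, hH⟩ := isFunOn_iff.1 (hF H w hHw).1
      exact ⟨h, (memOn_iff hG hH).1 hHG, (ih w hw hHw hH).symm⟩
    · rintro ⟨h, hhg, rfl⟩
      obtain ⟨H, hH⟩ := exists_represents h
      obtain ⟨H', w, hw, hHH, hwz⟩ := h2 H (isFunOn_iff.2 ⟨h, hH⟩) ((memOn_iff hG hH).2 hhg)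
      obtain ⟨h', hH'⟩ := isFunOn_iff.1 (hF H' w hw).1
      have := ih w hwz hw hH'
      rw [collapse_congr hU ((eqOn_iff hH hH').1 hHH)] at this
      exact this ▸ hwz

theorem exists_isPartialCollapse (g : A → ZFSet.{u}) :
    ∃ F, IsPartialCollapse (setCode (Set.univ : Set A)) (ultrafilterCode U) F ∧
      ∃ G, Related F G (collapse hU g) := by
  choose rep hrep using fun w : Set.range (collapse hU) => w.2
  choose G hG using fun w => exists_represents (rep w)
  -- The approximation lists, for each ultrapower element in a transitive level `V_o`, one chosen
  -- representative.
  obtain ⟨o, ho⟩ := ZFSet.exists_mem_vonNeumann (collapse hU g)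
  have htrans := ZFSet.isTransitive_vonNeumann o
  set Y := ZFSet.vonNeumann o
  let F : ZFSet.{u} := ZFSet.range
    fun w : {w : {w // w ∈ Y} // w.1 ∈ Set.range (collapse hU)} =>
      ZFSet.pair (G ⟨w.1.1, w.2⟩) w.1.1
  have hF : ∀ {H z}, Related F H z ↔ ∃ hz : z ∈ Set.range (collapse hU), z ∈ Y ∧ H = G ⟨z, hz⟩ := by
    intro H z
    simp only [related_iff, F, ZFSet.mem_range, ZFSet.pair_inj]
    constructor
    · rintro ⟨⟨⟨w, hw⟩, hw'⟩, h, rfl⟩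
      exact ⟨hw', hw, h.symm⟩
    · rintro ⟨hz, hzY, rfl⟩
      exact ⟨⟨⟨z, hzY⟩, hz⟩, rfl, rfl⟩
  refine ⟨F, fun H z hH => ?_, G ⟨_, g, rfl⟩, hF.2 ⟨⟨g, rfl⟩, ho, rfl⟩⟩
  obtain ⟨hz, hzY, rfl⟩ := hF.1 hH
  have hzr : collapse hU (rep ⟨z, hz⟩) = z := hrep ⟨z, hz⟩
  refine ⟨isFunOn_iff.2 ⟨_, hG _⟩, fun w hw => ?_, fun K hK hKG => ?_⟩
  · have hwr : w ∈ Set.range (collapse hU) := by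
      rw [mem_V, ← hzr, mem_collapse] at hw
      obtain ⟨k, -, hk⟩ := hw
      exact ⟨k, hk⟩
    refine ⟨G ⟨w, hwr⟩, hF.2 ⟨hwr, htrans z hzY hw, rfl⟩, (memOn_iff (hG _) (hG _)).2 ?_⟩
    rw [← collapse_mem_collapse hU, hrep, hrep]
    exact hw
  · obtain ⟨k, hk⟩ := isFunOn_iff.1 hK
    have hkz : collapse hU k ∈ z := by
      rw [memOn_iff (hG _) hk, ← collapse_mem_collapse hU, hzr] at hKG
      exact hKG
    refine ⟨G ⟨_, k, rfl⟩, collapse hU k, hF.2 ⟨⟨k, rfl⟩, htrans z hzY hkz, rfl⟩,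
      (eqOn_iff hk (hG _)).2 ?_, hkz⟩
    rw [← collapse_eq_iff hU, hrep]

theorem inUltrapower_iff {y : ZFSet.{u}} :
    InUltrapower (setCode (Set.univ : Set A)) (ultrafilterCode U) y ↔
      y ∈ Set.range (collapse hU) := by
  constructor
  · rintro ⟨F, hF, G, hG⟩
    obtain ⟨g, hg⟩ := isFunOn_iff.1 (hF G y hG).1
    exact ⟨g, (hF.eq_collapse hU hG hg).symm⟩
  · rintro ⟨g, rfl⟩
    exact exists_isPartialCollapse hU g

theorem isUltrapowerImage_iff {x y : ZFSet.{u}} :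
    IsUltrapowerImage (setCode (Set.univ : Set A)) (ultrafilterCode U) x y ↔
      collapse hU (fun _ => x) = y := by
  have key : ∀ {G : ZFSet.{u}} {g : A → ZFSet.{u}}, Represents G g →
      ((∃ B, Mem B (ultrafilterCode U) ∧ ∀ a, Mem a B → Related G a x) ↔
        (fun _ => x) =ᶠ[U] g) := fun {G g} hG =>
    Iff.trans exists_mem_ultrafilterCode (eventually_congr (.of_forall fun a => hG a x))
  constructor
  · rintro ⟨F, hF, G, hG, hx⟩
    obtain ⟨g, hg⟩ := isFunOn_iff.1 (hF G y hG).1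
    rw [hF.eq_collapse hU hG hg, collapse_eq_iff]
    exact (key hg).1 hx
  · rintro rfl
    obtain ⟨F, hF, G, hG⟩ := exists_isPartialCollapse hU fun _ => x
    obtain ⟨g, hg⟩ := isFunOn_iff.1 (hF _ _ hG).1
    refine ⟨F, hF, G, hG, (key hg).2 ?_⟩
    rw [← collapse_eq_iff hU, hF.eq_collapse hU hG hg]

/-- The ultrapower of the universe by a countably complete ultrafilter. -/
noncomputable def ultrapower : DefinableEmbedding.{u} where
  M := Set.range (collapse hU)
  transitive := by
    rintro _ ⟨f, rfl⟩ y hy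
    obtain ⟨g, -, h⟩ := (mem_collapse hU).1 hy
    exact ⟨g, h⟩
  definable_M := by
    have := (IsFirstOrder.inUltrapower.{u} (0 : Fin 3) 1 2).definable (β := Fin 1)
      ![.inl (setCode (Set.univ : Set A)), .inl (ultrafilterCode U), .inr 0]
    refine (congrArg (Set.univ.Definable setLang) (Set.ext fun v => ?_)).mp this
    exact inUltrapower_iff hU
  toElem := ultrapowerMap hU
  definable_graph := by
    have := (IsFirstOrder.isUltrapowerImage.{u} (0 : Fin 4) 1 2 3).definable (β := Fin 2)
      ![.inl (setCode (Set.univ : Set A)), .inl (ultrafilterCode U), .inr 0, .inr 1]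
    refine (congrArg (Set.univ.Definable setLang) (Set.ext fun v => ?_)).mp this
    exact isUltrapowerImage_iff hU

end Definability

end StronglyCompact

/-! ### Critical point and discontinuity of the ultrapower. -/

namespace StronglyCompact

open Filter

section CriticalPoint

variable {A : Type u} {U : Ultrafilter A} (hU : CountableInterFilter (U : Filter A))

theorem elt_eq_toZFSet {o : Ordinal.{u}} (i : o.ToType) :
    ∃ a < o, elt i = a.toZFSet := ⟨_, i.toOrd.2, rfl⟩

/-- Elements of `j α` are classes of functions into `α`; almost constant ones represent some `j x =
x`. -/
theorem ultrapower_app_eq_self {α : Ordinal.{u}}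
    (h : ∀ f : A → α.ToType, ∃ x, ∀ᶠ a in (U : Filter A), f a = x)
    (hfix : ∀ β < α, (ultrapower hU).app β.toZFSet = β.toZFSet) :
    (ultrapower hU).app α.toZFSet = α.toZFSet := by
  have hfix' : ∀ x : α.ToType, (ultrapower hU).app (elt x) = elt x := fun x => by
    obtain ⟨b, hb, hx⟩ := elt_eq_toZFSet x
    rw [hx, hfix b hb]
  ext z
  constructor
  · intro hz
    obtain ⟨g, hg, rfl⟩ := (mem_collapse hU).1 hz
    have hg' : ∀ᶠ a in (U : Filter A), ∃ x : α.ToType, elt x = g a :=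
      hg.mono fun a ha => mem_toZFSet_iff_elt.1 ha
    have : Nonempty α.ToType := let ⟨a, x, _⟩ := hg'.exists; ⟨x⟩
    choose! f hf using fun a (h : ∃ x : α.ToType, elt x = g a) => h
    obtain ⟨x, hx⟩ := h f
    have hgx : collapse hU g = (ultrapower hU).app (elt x) := by
      refine collapse_congr hU ?_
      filter_upwards [hg', hx] with a h1 h2
      rw [← h2, hf a h1]
    rw [hgx, hfix']
    exact mem_toZFSet_iff_elt.2 ⟨x, rfl⟩
  · intro hz
    obtain ⟨x, rfl⟩ := mem_toZFSet_iff_elt.1 hz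
    rw [← hfix' x, DefinableEmbedding.app_mem_app]
    exact hz

theorem eventually_const_of_ultrapower_app_eq_self {α : Ordinal.{u}}
    (hfix : ∀ β ≤ α, (ultrapower hU).app β.toZFSet = β.toZFSet) (f : A → α.ToType) :
    ∃ x, ∀ᶠ a in (U : Filter A), f a = x := by
  have h1 : collapse hU (fun a => elt (f a)) ∈ (ultrapower hU).app α.toZFSet :=
    (collapse_mem_collapse hU).2 (.of_forall fun a => mem_toZFSet_iff_elt.2 ⟨_, rfl⟩)
  rw [hfix α le_rfl] at h1
  obtain ⟨x, hx⟩ := mem_toZFSet_iff_elt.1 h1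
  refine ⟨x, ?_⟩
  obtain ⟨b, hb, hxb⟩ := elt_eq_toZFSet x
  have h2 : (ultrapower hU).app (elt x) = elt x := by rw [hxb, hfix b hb.le]
  have h3 := (collapse_eq_iff hU).1 (h2.trans hx)
  filter_upwards [h3] with a ha
  exact (elt_injective ha).symm

theorem exists_eventually_eq {δ : Cardinal.{u}} (hδ : CardinalInterFilter (U : Filter A) δ)
    {ι : Type u} (hι : #ι < δ) (f : A → ι) : ∃ x, ∀ᶠ a in (U : Filter A), f a = x := by
  by_contra! h
  obtain ⟨a, ha⟩ := ((eventually_cardinal_forall hι).2 h).exists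
  exact ha (f a) rfl

theorem ultrapower_app_eq_self_of_lt {δ : Cardinal.{u}}
    (hδ : CardinalInterFilter (U : Filter A) δ) {α : Ordinal.{u}} (hα : α < δ.ord) :
    (ultrapower hU).app α.toZFSet = α.toZFSet := by
  induction α using WellFoundedLT.induction with
  | _ α ih =>
    refine ultrapower_app_eq_self hU (exists_eventually_eq hδ ?_) fun β hβ => ih β hβ (hβ.trans hα)
    simpa using lt_ord.1 hα

/-- An ultrafilter that is not concentrated on a fibre of a map to a set of size at most `2 ^ κ`
moves an ordinal `α ≤ κ`. -/
theorem exists_ultrapower_app_ne {κ : Cardinal.{u}} (hκ : κ ≠ 0) {B : Type u}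
    (hB : #B ≤ 2 ^ κ) (p : A → B) (hp : ∀ b, ∀ᶠ a in (U : Filter A), p a ≠ b) :
    ∃ α ≤ κ.ord, (ultrapower hU).app α.toZFSet ≠ α.toZFSet := by
  by_contra! hfix
  have hconst := eventually_const_of_ultrapower_app_eq_self hU hfix
  obtain ⟨e⟩ : #B ≤ #(Set κ.ord.ToType) := by rwa [mk_set, mk_ord_toType]
  have : Nonempty κ.ord.ToType := by rwa [← mk_ne_zero_iff, mk_ord_toType]
  -- `c` is the `U`-limit of the sets `e (p a)`. A function picking a point where `e (p a)` differs
  -- from `c` is almost constant, which contradicts agreement at that point unless `e (p a) = c`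
  -- almost everywhere.
  let c : Set κ.ord.ToType := {i | ∀ᶠ a in (U : Filter A), i ∈ e (p a)}
  have hc : ∀ i, ∀ᶠ a in (U : Filter A), (i ∈ e (p a) ↔ i ∈ c) := fun i => by
    by_cases hi : i ∈ c
    · exact Eventually.mono (show ∀ᶠ a in (U : Filter A), i ∈ e (p a) from hi)
        fun a ha => by simp [ha, hi]
    · exact (Ultrafilter.eventually_not.2 hi).mono fun a ha => by simp [ha, hi]
  have hf : ∀ a, ∃ i, e (p a) ≠ c → ¬ (i ∈ e (p a) ↔ i ∈ c) := fun a => by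
    by_contra! h
    obtain ⟨i⟩ := this
    exact (h i).1 (Set.ext fun i => (h i).2)
  choose f hf using hf
  obtain ⟨x, hx⟩ := hconst f
  have h1 : ∀ᶠ a in (U : Filter A), e (p a) = c := by
    filter_upwards [hx, hc x] with a h1 h2
    by_contra h
    exact hf a h (h1 ▸ h2)
  obtain ⟨a₀, ha₀⟩ := h1.exists
  obtain ⟨a, h2, h3⟩ := (h1.and (hp (p a₀))).exists
  exact h3 (e.injective (h2.trans ha₀.symm))

/-- The class of `p` lies in `j o` and above every `j α` with `α < o`. -/
theorem ultrapower_supImageLT {o : Ordinal.{u}} (p : A → o.ToType)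
    (hp : ∀ x, ∀ᶠ a in (U : Filter A), x < p a) : (ultrapower hU).SupImageLT o := by
  have h1 : collapse hU (fun a => elt (p a)) ∈ (ultrapower hU).app o.toZFSet :=
    (collapse_mem_collapse hU).2 (.of_forall fun a => mem_toZFSet_iff_elt.2 ⟨_, rfl⟩)
  obtain ⟨o', ho'⟩ := (ultrapower hU).exists_app_toZFSet_eq o
  rw [ho', Ordinal.mem_toZFSet_iff] at h1
  obtain ⟨b, hb, hbc⟩ := h1
  have hub : b ∈ upperBounds
      {γ : Ordinal.{u} | ∃ α < o, (ultrapower hU).app α.toZFSet = γ.toZFSet} := by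
    rintro γ ⟨α, hα, hγ⟩
    refine le_of_lt ?_
    rw [← Ordinal.toZFSet_mem_toZFSet_iff, ← hγ, hbc]
    refine (collapse_mem_collapse hU).2 ((hp (Ordinal.ToType.mk ⟨α, hα⟩)).mono fun a ha => ?_)
    have ha' := Ordinal.ToType.mk.symm.lt_iff_lt.2 ha
    rw [OrderIso.symm_apply_apply] at ha'
    exact Ordinal.toZFSet_mem_toZFSet_iff.2 ha'
  refine ⟨_, isLUB_csSup' ⟨b, hub⟩, ?_⟩
  rw [ho', Ordinal.toZFSet_mem_toZFSet_iff]
  exact (csSup_le' hub).trans_lt hb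

end CriticalPoint

theorem cocardinal_neBot {I : Type u} {c : Cardinal.{u}} (hc : c.IsRegular) (hI : c ≤ #I) :
    (cocardinal I hc).NeBot := by
  refine ⟨fun h => ?_⟩
  have h' : (∅ : Set I) ∈ cocardinal I hc := h ▸ mem_bot
  rw [mem_cocardinal, Set.compl_empty, mk_univ] at h'
  exact h'.not_ge hI

theorem eventually_lt_cocardinal {c : Cardinal.{u}} (hc : c.IsRegular) (x : c.ord.ToType) :
    ∀ᶠ i in cocardinal c.ord.ToType hc, x < i := by
  have h : #(Set.Iio x) < c :=
    (mk_Iio_lt x (by rw [mk_ord_toType, Ordinal.type_toType])).trans_eq (mk_ord_toType c)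
  filter_upwards [eventually_cocardinal_notMem_of_card_lt h, eventually_cocardinal_ne x] with i h1 h2
  exact lt_of_le_of_ne (not_lt.1 h1) h2.symm

theorem IsStronglyCompact.exists_embedding {δ κ l : Cardinal.{u}} (h : IsStronglyCompact δ κ)
    (hδ : ℵ₀ < δ) (hδκ : δ ≤ κ) (hl : l.IsRegular) (hκl : κ ≤ l) :
    ∃ (j : DefinableEmbedding.{u}) (γ : Ordinal.{u}),
      j.IsCrit γ ∧ δ.ord ≤ γ ∧ γ ≤ κ.ord ∧ j.SupImageLT l.ord := by
  have hκ : ℵ₀ ≤ κ := hδ.le.trans hδκ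
  have hs : (Order.succ κ).IsRegular := isRegular_succ hκ
  -- This factor serves only to bound the critical point: `succ κ ≤ 2 ^ κ`, and no fibre of the
  -- first projection has measure one.
  let F₁ := cocardinal (Order.succ κ).ord.ToType hs
  let F₂ := cocardinal l.ord.ToType hl
  have : F₁.NeBot := cocardinal_neBot hs (mk_ord_toType _).ge
  have : F₂.NeBot := cocardinal_neBot hl (mk_ord_toType _).ge
  have : CardinalInterFilter F₁ κ :=
    CardinalInterFilter.of_cardinalInterFilter_of_le F₁ (Order.le_succ κ)
  have : CardinalInterFilter F₂ κ := CardinalInterFilter.of_cardinalInterFilter_of_le F₂ hκl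
  obtain ⟨U, hUF, hUδ⟩ := h _ (F₁ ×ˢ F₂) inferInstance
    (inferInstanceAs (CardinalInterFilter (F₁.comap Prod.fst ⊓ F₂.comap Prod.snd) κ))
  have hU : CountableInterFilter (U : Filter ((Order.succ κ).ord.ToType × l.ord.ToType)) :=
    CardinalInterFilter.toCountableInterFilter _ hδ
  obtain ⟨α, hακ, hα⟩ := exists_ultrapower_app_ne hU (aleph0_pos.trans_le hκ).ne'
    (B := (Order.succ κ).ord.ToType)
    (by rw [mk_ord_toType]; exact Order.succ_le_of_lt (cantor κ)) Prod.fst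
    fun b => hUF (tendsto_fst.eventually (eventually_cocardinal_ne b))
  let S : Set Ordinal.{u} := {α | (ultrapower hU).app α.toZFSet ≠ α.toZFSet}
  have hS : IsLeast S (sInf S) := ⟨csInf_mem (s := S) ⟨α, hα⟩, fun _ h => csInf_le' h⟩
  refine ⟨ultrapower hU, sInf S, hS, ?_, (hS.2 hα).trans hακ, ultrapower_supImageLT hU Prod.snd
    fun x => hUF (tendsto_snd.eventually (eventually_lt_cocardinal hl x))⟩
  by_contra! hlt
  exact hS.1 (ultrapower_app_eq_self_of_lt hU hUδ hlt)

end StronglyCompact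

theorem corollary2p10 (δ κ : Cardinal.{u}) (hδ : ℵ₀ < δ) (hδκ : δ ≤ κ) :
    List.TFAE [
      StronglyCompact.IsStronglyCompact δ κ,
      ∀ l : Cardinal.{u}, l.IsRegular → κ ≤ l →
        ∃ (j : StronglyCompact.DefinableEmbedding.{u}) (γ : Ordinal.{u}),
          j.IsCrit γ ∧ δ.ord ≤ γ ∧ γ ≤ κ.ord ∧ j.SupImageLT l.ord,
      ∀ l : Cardinal.{u}, l.IsRegular → κ ≤ l →
        ∃ (j : StronglyCompact.DefinableEmbedding.{u}) (γ : Ordinal.{u}),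
          j.IsCrit γ ∧ δ.ord ≤ γ ∧ j.SupImageLT l.ord] := by
  tfae_have 1 → 2 := fun h l hl hκl => h.exists_embedding hδ hδκ hl hκl
  tfae_have 2 → 3 := fun h l hl hκl =>
    let ⟨j, γ, h1, h2, _, h3⟩ := h l hl hκl
    ⟨j, γ, h1, h2, h3⟩
  tfae_have 3 → 1 := fun h =>
    StronglyCompact.isStronglyCompact_of_isTailComplete hδ (hδ.le.trans hδκ) fun l hl hκl =>
      let ⟨j, _, h1, h2, h3⟩ := h l hl hκl
      j.exists_isTailComplete hδ hl.aleph0_le h1 h2 h3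
  tfae_finish
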